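/- **Setting.** Let $A\in\mathbb R^{n_x\times n_x}$, $B\in\mathbb R^{n_x\times n_u}$ and consider the plant $x(k+1)=Ax(k)+Bu(k)+w(k)$, $w(k)\in\mathbb W$. Here $\mathbb W$ is a compact polytope, $\mathbb X\subset\mathbb R^{n_x}$ and $\mathbb U\subset\mathbb R^{n_u}$ are bounded sets of the form $\{x\mid Hx\le h\}$, and all three contain the origin in their interior. Let $K,\bar K\in\mathbb R^{n_u\times n_x}$ satisfy $\rho(A-BK)<1$ and $\rho(A-B\bar K)<1$. Put $\mathbb Z_K=\bigoplus_{i\ge 0}(A-BK)^i\mathbb W$, $\mathbb X_c=\mathbb X\ominus\mathbb Z_K$, $\mathbb U_c=\mathbb U\ominus(-K)\mathbb Z_K$ (Pontryagin differences), and suppose that $\mathbb X_c$ and $\mathbb U_c$ contain the origin in their interior. Let $N\ge1$, $\lambda\in(0,1)$, let $Q,R,T$ be symmetric positive definite, and let $P=(A-B\bar K)^\top P(A-B\bar K)+Q+\bar K^\top R\bar K$. Write $\|v\|_M^2=v^\top Mv$. Let $X_f^\lambda$ be the set of $(x,\bar x,\bar u)$ with $\bar x\in\lambda\mathbb X_c$,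 $\bar u\in\lambda\mathbb U_c$, such that the recursion $x_0=x$, $x_{k+1}=Ax_k+Bu_k$, $u_k=\bar u-\bar K(x_k-\bar x)$ satisfies $x_k\in\mathbb X_c$ and $u_k\in\mathbb U_c$ for all $k\ge0$. A pair $(\bar x,\bar u)$ is *steady* if $(A-I)\bar x+B\bar u=0$. **Network.** $\theta_k,\gamma_k\in\{0,1\}$ are random; $\theta_k=1$ (resp. $\gamma_k=1$) means that the packet sent at time $k$ from controller to plant (resp. from plant to controller) is received, and $\mathrm{Prob}\big(\bigcap_{t\ge k}\{\gamma_{t-1}\theta_t=0\}\big)=0$ for all $k\ge1$. Let $q_{k+1}=k$ if $\gamma_k=1$ and $q_{k+1}=q_k$ otherwise. Let $\Theta_k=1$ if $\theta_k=1$ and $\theta_i=1$ for all $q_k<i\le k$, and $\Theta_k=0$ otherwise. Let $s_k=k$ if $\Theta_k=1$ and $s_k=s_{k-1}$ otherwise. **Extended MPC with state feedback.** Given a constant reference $x_r$ and the estimate $\hat x(k|k-1)$, the controller computes at each time $k$ at which the following problem is feasible an optimal solution $(\mathbf u_k^*,\mathbf x_k^*,\bar x_k^*,\bar u_k^*)$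 of: minimize $$\sum_{i=0}^{N-1}\big(\|\mathbf x(i)-\bar x\|_Q^2+\|\mathbf u(i)-\bar u\|_R^2\big)+\|\mathbf x(N)-\bar x\|_P^2+\|\bar x-x_r\|_T^2$$ subject to $\mathbf x(i+1)=A\mathbf x(i)+B\mathbf u(i)$, $\mathbf x(i)\in\mathbb X_c$, $\mathbf u(i)\in\mathbb U_c$ for $0\le i<N$, $(\mathbf x(N),\bar x,\bar u)\in X_f^\lambda$, $(\bar x,\bar u)$ steady, and the initial condition $\{\hat x(k|k-1)\}\oplus\mathbb W\subseteq\{\mathbf x(0)\}\oplus\mathbb Z_K$ if $\gamma_{k-1}=1$, respectively $\mathbf x(0)=\hat x(k|k-1)$ otherwise. The estimator is $\hat x(k+1|k)=A\hat x(k|k)+B\hat u(k|k)$ with $(\hat x(k|k),\hat u(k|k))=(x(k),u(k))$ if $\gamma_k=1$ and $(\mathbf x_k^*(0),\mathbf u_k^*(0))$ otherwise. The nominal state is $x_n(k)=\mathbf x_k^*(0)$ if $\Theta_k=1$ and $x_n(k)=Ax_n(k-1)+Bu_n(k-1)$ otherwise. Once a packet with $\Theta_j=1$ has arrived, the nominal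 input is $u_n(k)=\mathbf u_{s_k}^*(k-s_k)$ if $k-s_k<N$ and $u_n(k)=\bar u_{s_k}^*+\bar K\bar x_{s_k}^*-\bar Kx_n(k)$ otherwise. The plant input is $u(k)=u_n(k)-K(x(k)-x_n(k))$. Initial values, and the inputs and plans not specified by these rules, are arbitrary. **Statement.** Let $(x_r,\tilde u)$ be steady, and suppose that almost surely there is a $k_0\ge1$ with $\gamma_{k_0-1}=1$ and $\theta_{k_0}=1$ at which the extended MPC problem is feasible. Then $\|x-x_r\|_T^2$ has a unique minimizer $\tilde x_r$ over the set of admissible steady states $\{x\in\lambda\mathbb X_c\mid \exists u\in\lambda\mathbb U_c:\ (A-I)x+Bu=0\}$. If $x_r\in\lambda\mathbb X_c$ and $\tilde u\in\lambda\mathbb U_c$, then $\tilde x_r=x_r$. Almost surely, $x(k)$ converges to the set $\{\tilde x_r\}\oplus\mathbb Z_K$, i.e. $\mathrm{dist}\big(x(k),\{\tilde x_r\}\oplus\mathbb Z_K\big)\to0$ as $k\to\infty$, and $x(k)\in\{\tilde x_r\}\oplus\mathbb X$ for all sufficiently large $k$. -/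

import Mathlib

open Filter Topology MeasureTheory Matrix
open scoped Pointwise

/-- The polyhedron `{x | H x ≤ h}` (componentwise inequality). -/
def polyhedron {m n : ℕ} (H : Matrix (Fin m) (Fin n) ℝ) (h : Fin m → ℝ) : Set (Fin n → ℝ) :=
  {x | ∀ i, (H *ᵥ x) i ≤ h i}

/-- The Pontryagin difference `P ⊖ S`. -/
def pontryaginDiff {n : ℕ} (P S : Set (Fin n → ℝ)) : Set (Fin n → ℝ) :=
  {x | ∀ s ∈ S, x + s ∈ P}

/-- The weighted squared norm `‖x‖_M² = xᵀ M x`. -/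
def wnormSq {n : ℕ} (M : Matrix (Fin n) (Fin n) ℝ) (x : Fin n → ℝ) : ℝ :=
  x ⬝ᵥ (M *ᵥ x)

/-- `ρ(M) < 1`: every complex eigenvalue of the real matrix `M` has modulus less than one. -/
def IsSchurStable {n : ℕ} (M : Matrix (Fin n) (Fin n) ℝ) : Prop :=
  spectralRadius ℂ (M.map (algebraMap ℝ ℂ)) < 1

/-- The design data: plant `(A, B)`, ancillary gain `K`, steady-state gain `Kbar`, cost matrices
`Q, R, T` and terminal cost matrix `P`, horizon `N`, scaling `lam`, and the inequalities describing
the state, input and disturbance polytopes. -/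
structure TubeMPC (nx nu mx mu mw : ℕ) where
  A : Matrix (Fin nx) (Fin nx) ℝ
  B : Matrix (Fin nx) (Fin nu) ℝ
  K : Matrix (Fin nu) (Fin nx) ℝ
  Kbar : Matrix (Fin nu) (Fin nx) ℝ
  Q : Matrix (Fin nx) (Fin nx) ℝ
  R : Matrix (Fin nu) (Fin nu) ℝ
  T : Matrix (Fin nx) (Fin nx) ℝ
  P : Matrix (Fin nx) (Fin nx) ℝ
  N : ℕ
  lam : ℝ
  Hx : Matrix (Fin mx) (Fin nx) ℝ
  hx : Fin mx → ℝ
  Hu : Matrix (Fin mu) (Fin nu) ℝ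
  hu : Fin mu → ℝ
  Hw : Matrix (Fin mw) (Fin nx) ℝ
  hw : Fin mw → ℝ

/-- A candidate solution of the MPC problem: predicted inputs and states and an artificial steady
state `(xbar, ubar)`.  Only `u 0, …, u (N-1)` and `x 0, …, x N` are used. -/
structure MPCPlan (nx nu : ℕ) where
  u : ℕ → Fin nu → ℝ
  x : ℕ → Fin nx → ℝ
  xbar : Fin nx → ℝ
  ubar : Fin nu → ℝ

/-- All signals of the networked control loop along one sample path. -/
structure LoopPath (nx nu : ℕ) where
  /-- `θ k`: packet from the controller received by the plant at time `k` -/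
  θ : ℕ → Bool
  /-- `γ k`: packet from the plant sent at time `k` received by the controller -/
  γ : ℕ → Bool
  /-- disturbance -/
  w : ℕ → Fin nx → ℝ
  /-- plant state -/
  x : ℕ → Fin nx → ℝ
  /-- plant input -/
  u : ℕ → Fin nu → ℝ
  /-- nominal state (after the update at time `k`) -/
  xn : ℕ → Fin nx → ℝ
  /-- nominal input -/
  un : ℕ → Fin nu → ℝ
  /-- predicted estimate: `xpred k` is the estimate of the state at time `k` made at `k - 1` -/
  xpred : ℕ → Fin nx → ℝ
  /-- filtered state estimate at time `k` -/
  xfilt : ℕ → Fin nx → ℝ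
  /-- filtered input estimate at time `k` -/
  ufilt : ℕ → Fin nu → ℝ
  /-- plan computed by the MPC at time `k` and sent in the controller packet -/
  plan : ℕ → MPCPlan nx nu
  /-- time of the last plant packet received by the controller before time `k` -/
  q : ℕ → ℤ
  /-- index of the controller packet in use at the plant at time `k` -/
  s : ℕ → ℕ

namespace LoopPath

variable {nx nu : ℕ}

/-- `Θ_k = 1`: the packet sent at time `k` arrives, and so did all controller packets sent since
the last plant packet known to the controller. -/
def Consistent (p : LoopPath nx nu) (k : ℕ) : Prop :=
  p.θ k = true ∧ ∀ i : ℕ, p.q k < (i : ℤ) → i ≤ k → p.θ i = true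

/-- `γ_{k-1} = 1`; false at time `0`. -/
def PrevReceived (p : LoopPath nx nu) : ℕ → Prop
  | 0 => False
  | k + 1 => p.γ k = true

end LoopPath

namespace TubeMPC

variable {nx nu mx mu mw : ℕ}

/-- State constraint set. -/
def X (D : TubeMPC nx nu mx mu mw) : Set (Fin nx → ℝ) := polyhedron D.Hx D.hx

/-- Input constraint set. -/
def U (D : TubeMPC nx nu mx mu mw) : Set (Fin nu → ℝ) := polyhedron D.Hu D.hu

/-- Disturbance set. -/
def W (D : TubeMPC nx nu mx mu mw) : Set (Fin nx → ℝ) := polyhedron D.Hw D.hw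

/-- The minimal robust positively invariant set `⨁_{i ≥ 0} (A - BK)^i W`: all sums of convergent
series `∑ (A - BK)^i w_i` with `w_i ∈ W`. -/
def Z (D : TubeMPC nx nu mx mu mw) : Set (Fin nx → ℝ) :=
  {z | ∃ w : ℕ → Fin nx → ℝ, (∀ i, w i ∈ D.W) ∧
    HasSum (fun i => ((D.A - D.B * D.K) ^ i) *ᵥ w i) z}

/-- Tightened state constraint set `X ⊖ Z`. -/
def Xc (D : TubeMPC nx nu mx mu mw) : Set (Fin nx → ℝ) := pontryaginDiff D.X D.Z

/-- Tightened input constraint set `U ⊖ (-K) Z`. -/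
def Uc (D : TubeMPC nx nu mx mu mw) : Set (Fin nu → ℝ) :=
  pontryaginDiff D.U ((fun z => (-D.K) *ᵥ z) '' D.Z)

/-- The steady-state equation `(A - I) x̄ + B ū = 0`. -/
def IsSteady (D : TubeMPC nx nu mx mu mw) (xb : Fin nx → ℝ) (ub : Fin nu → ℝ) : Prop :=
  (D.A - 1) *ᵥ xb + D.B *ᵥ ub = 0

/-- The nominal state at time `k` under the law `u = ū - K̄ (x - x̄)`, started in `x`; this is the
first component of `A_a ^ k (x, x̄, ū)`, the other two being constant. -/
def terminalState (D : TubeMPC nx nu mx mu mw) (x xb : Fin nx → ℝ) (ub : Fin nu → ℝ) :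
    ℕ → Fin nx → ℝ
  | 0 => x
  | k + 1 => (D.A - D.B * D.Kbar) *ᵥ D.terminalState x xb ub k
      + (D.B * D.Kbar) *ᵥ xb + D.B *ᵥ ub

/-- Membership of `(x, x̄, ū)` in the maximal admissible set for the law `u = ū - K̄ (x - x̄)`. -/
def InMaxAdmissible (D : TubeMPC nx nu mx mu mw) (x xb : Fin nx → ℝ) (ub : Fin nu → ℝ) : Prop :=
  ∀ k : ℕ, D.terminalState x xb ub k ∈ D.Xc ∧
    ub - D.Kbar *ᵥ (D.terminalState x xb ub k - xb) ∈ D.Uc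

/-- Membership of `(x, x̄, ū)` in the terminal set: the maximal admissible set, intersected with
`x̄ ∈ λ Xc` and `ū ∈ λ Uc`. -/
def InTerminalSet (D : TubeMPC nx nu mx mu mw) (x xb : Fin nx → ℝ) (ub : Fin nu → ℝ) : Prop :=
  D.InMaxAdmissible x xb ub ∧ xb ∈ D.lam • D.Xc ∧ ub ∈ D.lam • D.Uc

/-- The MPC cost. -/
def cost (D : TubeMPC nx nu mx mu mw) (xr : Fin nx → ℝ) (m : MPCPlan nx nu) : ℝ :=
  (∑ i ∈ Finset.range D.N, (wnormSq D.Q (m.x i - m.xbar) + wnormSq D.R (m.u i - m.ubar)))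
    + (wnormSq D.P (m.x D.N - m.xbar) + wnormSq D.T (m.xbar - xr))

/-- The constraints of the extended MPC problem, given the predicted estimate `xhat`.  The initial
condition depends on whether the previous plant packet was received (`rcv`). -/
structure Feasible (D : TubeMPC nx nu mx mu mw) (rcv : Prop) (xhat : Fin nx → ℝ)
    (m : MPCPlan nx nu) : Prop where
  dynamics : ∀ i < D.N, m.x (i + 1) = D.A *ᵥ m.x i + D.B *ᵥ m.u i
  state_mem : ∀ i < D.N, m.x i ∈ D.Xc
  input_mem : ∀ i < D.N, m.u i ∈ D.Uc
  init_received : rcv → {xhat} + D.W ⊆ {m.x 0} + D.Z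
  init_lost : ¬ rcv → m.x 0 = xhat
  terminal : D.InTerminalSet (m.x D.N) m.xbar m.ubar
  steady : D.IsSteady m.xbar m.ubar

/-- `m` is an optimal solution of the extended MPC problem. -/
def IsOptimal (D : TubeMPC nx nu mx mu mw) (xr : Fin nx → ℝ) (rcv : Prop) (xhat : Fin nx → ℝ)
    (m : MPCPlan nx nu) : Prop :=
  D.Feasible rcv xhat m ∧ ∀ m', D.Feasible rcv xhat m' → D.cost xr m ≤ D.cost xr m'

/-- The extended MPC problem at time `k` of the path `p` has a feasible point. -/
def FeasibleAt (D : TubeMPC nx nu mx mu mw) (p : LoopPath nx nu) (k : ℕ) : Prop :=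
  ∃ m, D.Feasible (p.PrevReceived k) (p.xpred k) m

/-- `p` is a path of the closed loop with the extended MPC (state feedback), the consistent actuator
with nominal state update, and the ancillary controller, for the constant reference `xr`.
The initial values of `x`, `xn`, `xpred`, `q`, `s`, the nominal input before the first consistent
packet, and the plan when the MPC problem is infeasible are arbitrary. -/
structure IsClosedLoop (D : TubeMPC nx nu mx mu mw) (xr : Fin nx → ℝ) (p : LoopPath nx nu) :
    Prop where
  /-- the disturbance is admissible -/
  dist_mem : ∀ k, p.w k ∈ D.W
  /-- plant -/
  plant : ∀ k, p.x (k + 1) = D.A *ᵥ p.x k + D.B *ᵥ p.u k + p.w k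
  /-- ancillary controller -/
  ancillary : ∀ k, p.u k = p.un k - D.K *ᵥ (p.x k - p.xn k)
  /-- nominal plant, when no consistent packet arrives -/
  nominal : ∀ k, ¬ p.Consistent (k + 1) → p.xn (k + 1) = D.A *ᵥ p.xn k + D.B *ᵥ p.un k
  /-- nominal state update, when a consistent packet arrives -/
  nominal_update : ∀ k, p.Consistent k → p.xn k = (p.plan k).x 0
  /-- index of the packet in use -/
  s_consistent : ∀ k, p.Consistent k → p.s k = k
  s_keep : ∀ k, ¬ p.Consistent (k + 1) → p.s (k + 1) = p.s k
  /-- consistent actuator -/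
  actuator : ∀ k, (∃ j ≤ k, p.Consistent j) →
    p.un k = if k - p.s k < D.N then (p.plan (p.s k)).u (k - p.s k)
      else (p.plan (p.s k)).ubar + D.Kbar *ᵥ (p.plan (p.s k)).xbar - D.Kbar *ᵥ p.xn k
  /-- estimator with state feedback -/
  filt_state : ∀ k, p.xfilt k = if p.γ k then p.x k else (p.plan k).x 0
  filt_input : ∀ k, p.ufilt k = if p.γ k then p.u k else (p.plan k).u 0
  predict : ∀ k, p.xpred (k + 1) = D.A *ᵥ p.xfilt k + D.B *ᵥ p.ufilt k
  /-- time of the last received plant packet -/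
  q_update : ∀ k, p.q (k + 1) = if p.γ k then (k : ℤ) else p.q k
  /-- the MPC returns an optimal solution whenever its problem is feasible -/
  optimal : ∀ k, D.FeasibleAt p k → D.IsOptimal xr (p.PrevReceived k) (p.xpred k) (p.plan k)

/-- The standing assumptions on the design data. -/
structure Assumptions (D : TubeMPC nx nu mx mu mw) : Prop where
  horizon_pos : 1 ≤ D.N
  lam_pos : 0 < D.lam
  lam_lt_one : D.lam < 1
  W_compact : IsCompact D.W
  W_zero : (0 : Fin nx → ℝ) ∈ interior D.W
  X_bounded : Bornology.IsBounded D.X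
  X_zero : (0 : Fin nx → ℝ) ∈ interior D.X
  U_bounded : Bornology.IsBounded D.U
  U_zero : (0 : Fin nu → ℝ) ∈ interior D.U
  Xc_zero : (0 : Fin nx → ℝ) ∈ interior D.Xc
  Uc_zero : (0 : Fin nu → ℝ) ∈ interior D.Uc
  Q_posDef : D.Q.PosDef
  R_posDef : D.R.PosDef
  T_posDef : D.T.PosDef
  K_stable : IsSchurStable (D.A - D.B * D.K)
  Kbar_stable : IsSchurStable (D.A - D.B * D.Kbar)
  P_eq : D.P = (D.A - D.B * D.Kbar)ᵀ * D.P * (D.A - D.B * D.Kbar) + D.Q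
    + D.Kbarᵀ * D.R * D.Kbar

/-- The admissible steady states: steady states in `λ Xc` with a steady-state input in `λ Uc`. -/
def admissibleSteadyStates (D : TubeMPC nx nu mx mu mw) : Set (Fin nx → ℝ) :=
  {x | x ∈ D.lam • D.Xc ∧ ∃ u ∈ D.lam • D.Uc, D.IsSteady x u}

/-- The minimizers of `‖x - xr‖_T²` over the admissible steady states. -/
def targets (D : TubeMPC nx nu mx mu mw) (xr : Fin nx → ℝ) : Set (Fin nx → ℝ) :=
  {x | x ∈ D.admissibleSteadyStates ∧
    ∀ y ∈ D.admissibleSteadyStates, wnormSq D.T (x - xr) ≤ wnormSq D.T (y - xr)}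

end TubeMPC

/-- Network assumption: for every time `k`, almost surely some two consecutive transmissions after
`k`, first from plant to controller and then from controller to plant, are both successful. -/
def NetworkAssumption {Ω : Type*} [MeasurableSpace Ω] (μ : Measure Ω) {nx nu : ℕ}
    (S : Ω → LoopPath nx nu) : Prop :=
  ∀ k : ℕ, μ (⋂ t ≥ k, {ω | ¬ ((S ω).γ t = true ∧ (S ω).θ (t + 1) = true)}) = 0

/-! ### Quadratic forms -/

section QuadraticForm

variable {n : ℕ}

/-! The argument is deterministic on each sample path outside a null set. Once a plan reaches the
plant right after a received plant packet, the error between plant and nominal state lies in `Z`. It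
stays there because `Z` is invariant under `A - BK` plus disturbances, so it remains to drive the
nominal state to the target.

Plans are read as infinite ones, continued by the terminal law (`IsAdmissible`). The nominal system
always follows such a plan, `activePlan`: without a consistent packet its first step is dropped, and
a consistent packet replaces it by an optimal plan, for which the shortened old plan was a feasible
competitor (`Tracking.succ`, `Tracking.cost_succ_le`). As `P` is the exact cost-to-go of the
terminal law, the cost falls by at least the stage cost. Hence stage costs vanish, and nominal state
and input approach the artificial steady state.

To bring that steady state to the target, let a competitor move it a fixed fraction of the way. This
shrinks the excess cost by a fixed factor, up to a vanishing error (`exists_cost_contraction`). The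
network assumption makes the optimizer beat this competitor infinitely often, so the monotone excess
tends to zero (`tendsto_target`); it bounds the squared distance to the target by
`wnormSq_target_add_le`. -/

theorem wnormSq_zero (M : Matrix (Fin n) (Fin n) ℝ) : wnormSq M 0 = 0 := by
  simp [wnormSq]

theorem wnormSq_smul (M : Matrix (Fin n) (Fin n) ℝ) (c : ℝ) (x : Fin n → ℝ) :
    wnormSq M (c • x) = c ^ 2 * wnormSq M x := by
  simp only [wnormSq, mulVec_smul, dotProduct_smul, smul_dotProduct, smul_eq_mul]
  ring

theorem wnormSq_neg (M : Matrix (Fin n) (Fin n) ℝ) (x : Fin n → ℝ) :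
    wnormSq M (-x) = wnormSq M x := by
  simp [wnormSq, mulVec_neg]

theorem wnormSq_segment (M : Matrix (Fin n) (Fin n) ℝ) (t : ℝ) (a b : Fin n → ℝ) :
    wnormSq M ((1 - t) • a + t • b) =
      (1 - t) * wnormSq M a + t * wnormSq M b - t * (1 - t) * wnormSq M (b - a) := by
  simp only [wnormSq, mulVec_add, mulVec_sub, mulVec_smul, dotProduct_add, add_dotProduct,
    dotProduct_sub, sub_dotProduct, dotProduct_smul, smul_dotProduct, smul_eq_mul]
  ring

theorem continuous_wnormSq (M : Matrix (Fin n) (Fin n) ℝ) : Continuous (wnormSq M) := by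
  unfold wnormSq
  fun_prop

theorem wnormSq_pos {M : Matrix (Fin n) (Fin n) ℝ} (hM : M.PosDef) {x : Fin n → ℝ} (hx : x ≠ 0) :
    0 < wnormSq M x := by
  simpa [wnormSq] using hM.dotProduct_mulVec_pos hx

theorem wnormSq_nonneg {M : Matrix (Fin n) (Fin n) ℝ} (hM : M.PosDef) (x : Fin n → ℝ) :
    0 ≤ wnormSq M x := by
  rcases eq_or_ne x 0 with rfl | hx
  · rw [wnormSq_zero]
  · exact (wnormSq_pos hM hx).le

theorem wnormSq_eq_norm_sq_mul (M : Matrix (Fin n) (Fin n) ℝ) {x : Fin n → ℝ} (hx : x ≠ 0) :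
    wnormSq M x = ‖x‖ ^ 2 * wnormSq M (‖x‖⁻¹ • x) := by
  rw [wnormSq_smul, ← mul_assoc, ← mul_pow, mul_inv_cancel₀ (norm_ne_zero_iff.2 hx), one_pow,
    one_mul]

theorem inv_norm_smul_mem_sphere {x : Fin n → ℝ} (hx : x ≠ 0) :
    ‖x‖⁻¹ • x ∈ Metric.sphere (0 : Fin n → ℝ) 1 := by
  simp [norm_smul, inv_mul_cancel₀ (norm_ne_zero_iff.2 hx)]

theorem exists_wnormSq_le (M : Matrix (Fin n) (Fin n) ℝ) :
    ∃ C > 0, ∀ x, wnormSq M x ≤ C * ‖x‖ ^ 2 := by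
  obtain ⟨C, hC⟩ := (isCompact_sphere (0 : Fin n → ℝ) 1).bddAbove_image
    (continuous_wnormSq M).continuousOn
  refine ⟨max C 1, by positivity, fun x => ?_⟩
  rcases eq_or_ne x 0 with rfl | hx
  · simp [wnormSq_zero]
  · rw [wnormSq_eq_norm_sq_mul M hx, mul_comm]
    gcongr
    exact (hC (Set.mem_image_of_mem _ (inv_norm_smul_mem_sphere hx))).trans (le_max_left _ _)

theorem exists_le_wnormSq {M : Matrix (Fin n) (Fin n) ℝ} (hM : M.PosDef) :
    ∃ c > 0, ∀ x, c * ‖x‖ ^ 2 ≤ wnormSq M x := by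
  obtain hne | hne := (Metric.sphere (0 : Fin n → ℝ) 1).eq_empty_or_nonempty
  -- The unit sphere is empty only in dimension zero, where any constant works.
  · refine ⟨1, one_pos, fun x => ?_⟩
    rcases eq_or_ne x 0 with rfl | hx
    · simp [wnormSq_zero]
    · exact absurd (inv_norm_smul_mem_sphere hx) (by simp [hne])
  · obtain ⟨y, hy, hmin⟩ := (isCompact_sphere (0 : Fin n → ℝ) 1).exists_isMinOn hne
      (continuous_wnormSq M).continuousOn
    have hy0 : y ≠ 0 := by
      rintro rfl
      simp at hy
    refine ⟨wnormSq M y, wnormSq_pos hM hy0, fun x => ?_⟩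
    rcases eq_or_ne x 0 with rfl | hx
    · simp [wnormSq_zero]
    · rw [wnormSq_eq_norm_sq_mul M hx, mul_comm]
      gcongr
      exact hmin (inv_norm_smul_mem_sphere hx)

theorem tendsto_zero_of_wnormSq {M : Matrix (Fin n) (Fin n) ℝ} (hM : M.PosDef)
    {v : ℕ → Fin n → ℝ} (h : Tendsto (fun k => wnormSq M (v k)) atTop (𝓝 0)) :
    Tendsto v atTop (𝓝 0) := by
  obtain ⟨c, hc, hcM⟩ := exists_le_wnormSq hM
  have h2 : Tendsto (fun k => ‖v k‖ ^ 2) atTop (𝓝 0) := by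
    refine squeeze_zero (fun k => by positivity) (fun k => ?_)
      (by simpa using h.const_mul c⁻¹ : Tendsto (fun k => c⁻¹ * wnormSq M (v k)) atTop (𝓝 0))
    rw [inv_mul_eq_div, le_div_iff₀ hc, mul_comm]
    exact hcM _
  rw [tendsto_zero_iff_norm_tendsto_zero]
  simpa [Real.sqrt_sq] using h2.sqrt

/-- First-order optimality for the minimization of `‖x - r‖_M²` over a convex set. -/
theorem wnormSq_sub_le_of_isMin (M : Matrix (Fin n) (Fin n) ℝ) {S : Set (Fin n → ℝ)}
    (hS : Convex ℝ S) {r a b : Fin n → ℝ} (ha : a ∈ S)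
    (hmin : ∀ y ∈ S, wnormSq M (a - r) ≤ wnormSq M (y - r)) (hb : b ∈ S) :
    wnormSq M (a - r) + wnormSq M (b - a) ≤ wnormSq M (b - r) := by
  have key : ∀ t ∈ Set.Ioc (0 : ℝ) 1,
      wnormSq M (a - r) + (1 - t) * wnormSq M (b - a) ≤ wnormSq M (b - r) := by
    rintro t ⟨ht0, ht1⟩
    -- Compare `a` with a point of the segment to `b`, divide by `t`, and let `t` tend to zero.
    have h := hmin _ (hS ha hb (sub_nonneg.2 ht1) ht0.le (by ring))
    have e : (1 - t) • a + t • b - r = (1 - t) • (a - r) + t • (b - r) := by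
      module
    rw [e, wnormSq_segment, sub_sub_sub_cancel_right] at h
    have h' : 0 ≤ t * (wnormSq M (b - r) - wnormSq M (a - r) - (1 - t) * wnormSq M (b - a)) := by
      linarith
    have := nonneg_of_mul_nonneg_right h' ht0
    linarith
  have hlim : Tendsto (fun t : ℝ => wnormSq M (a - r) + (1 - t) * wnormSq M (b - a)) (𝓝[>] 0)
      (𝓝 (wnormSq M (a - r) + (1 - 0) * wnormSq M (b - a))) :=
    (Continuous.tendsto (by fun_prop) 0).mono_left nhdsWithin_le_nhds
  rw [sub_zero, one_mul] at hlim
  exact le_of_tendsto hlim (by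
    filter_upwards [Ioc_mem_nhdsGT one_pos] with t ht using key t ht)

end QuadraticForm

/-! ### Powers of Schur stable matrices -/

section Schur

variable {n : ℕ}

-- Gelfand's formula: `‖M ^ k‖` is eventually at most `r ^ k` for some `r < 1`.
open scoped Matrix.Norms.Operator in
theorem tendsto_pow_of_spectralRadius_lt_one {M : Matrix (Fin n) (Fin n) ℂ}
    (hM : spectralRadius ℂ M < 1) : Tendsto (fun k => M ^ k) atTop (𝓝 0) := by
  obtain ⟨r, hr, hr1⟩ := ENNReal.lt_iff_exists_nnreal_btwn.1 hM
  have hr1' : r < 1 := by exact_mod_cast hr1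
  have h := spectrum.pow_nnnorm_pow_one_div_tendsto_nhds_spectralRadius M
  refine tendsto_zero_iff_norm_tendsto_zero.2 ?_
  refine squeeze_zero' (Eventually.of_forall fun k => norm_nonneg _) ?_
    (tendsto_pow_atTop_nhds_zero_of_lt_one r.coe_nonneg (by exact_mod_cast hr1'))
  filter_upwards [h.eventually_lt_const hr, eventually_gt_atTop 0] with k hk hk0
  have hk' : (0 : ℝ) < k := by exact_mod_cast hk0
  have h2 := ENNReal.rpow_le_rpow hk.le hk'.le
  rw [← ENNReal.rpow_mul, one_div_mul_cancel hk'.ne', ENNReal.rpow_one, ENNReal.rpow_natCast] at h2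
  have h3 : ‖M ^ k‖₊ ≤ r ^ k := by exact_mod_cast h2
  exact_mod_cast h3

theorem IsSchurStable.tendsto_pow {M : Matrix (Fin n) (Fin n) ℝ} (hM : IsSchurStable M) :
    Tendsto (fun k => M ^ k) atTop (𝓝 0) := by
  have h := tendsto_pow_of_spectralRadius_lt_one hM
  have hre : Continuous fun L : Matrix (Fin n) (Fin n) ℂ => L.map Complex.re :=
    continuous_id.matrix_map Complex.continuous_re
  have h2 := (hre.tendsto 0).comp h
  have e : ∀ k, ((M.map (algebraMap ℝ ℂ)) ^ k).map Complex.re = M ^ k := fun k => by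
    have : (M.map (algebraMap ℝ ℂ)) ^ k = (M ^ k).map (algebraMap ℝ ℂ) :=
      (map_pow (algebraMap ℝ ℂ).mapMatrix M k).symm
    rw [this]
    ext i j
    simp
  have e0 : (0 : Matrix (Fin n) (Fin n) ℂ).map Complex.re = 0 := by
    ext i j
    simp
  simpa only [Function.comp_def, e, e0] using h2

open scoped Matrix.Norms.Operator in
theorem exists_norm_mulVec_le {m : ℕ} (L : Matrix (Fin m) (Fin n) ℝ) :
    ∃ C > 0, ∀ v, ‖L *ᵥ v‖ ≤ C * ‖v‖ := by
  refine ⟨‖L‖ + 1, by positivity, fun v => (linfty_opNorm_mulVec L v).trans ?_⟩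
  gcongr
  linarith

open scoped Matrix.Norms.Operator in
theorem IsSchurStable.exists_norm_pow_mulVec_le {M : Matrix (Fin n) (Fin n) ℝ}
    (hM : IsSchurStable M) : ∃ C > 0, ∀ k v, ‖(M ^ k) *ᵥ v‖ ≤ C * ‖v‖ := by
  obtain ⟨C, hC⟩ := isBounded_iff_forall_norm_le.1
    (Metric.isBounded_range_of_tendsto _ hM.tendsto_pow)
  refine ⟨max C 1, by positivity, fun k v => (linfty_opNorm_mulVec _ v).trans ?_⟩
  gcongr
  exact (hC _ (Set.mem_range_self k)).trans (le_max_left _ _)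

theorem IsSchurStable.tendsto_pow_mulVec {M : Matrix (Fin n) (Fin n) ℝ}
    (hM : IsSchurStable M) (v : Fin n → ℝ) : Tendsto (fun k => (M ^ k) *ᵥ v) atTop (𝓝 0) := by
  have h : Continuous fun L : Matrix (Fin n) (Fin n) ℝ => L *ᵥ v := by fun_prop
  simpa [Function.comp_def] using (h.tendsto 0).comp hM.tendsto_pow

end Schur

/-! ### Polyhedra and Pontryagin differences -/

section Sets

variable {m n : ℕ}

theorem convex_polyhedron (H : Matrix (Fin m) (Fin n) ℝ) (h : Fin m → ℝ) :
    Convex ℝ (polyhedron H h) := by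
  intro x hx y hy a b ha hb hab i
  have h1 := mul_le_mul_of_nonneg_left (hx i) ha
  have h2 := mul_le_mul_of_nonneg_left (hy i) hb
  have h3 : a * h i + b * h i = h i := by rw [← add_mul, hab, one_mul]
  simp only [mulVec_add, mulVec_smul, Pi.add_apply, Pi.smul_apply, smul_eq_mul]
  linarith

theorem isClosed_polyhedron (H : Matrix (Fin m) (Fin n) ℝ) (h : Fin m → ℝ) :
    IsClosed (polyhedron H h) := by
  have : polyhedron H h = ⋂ i, {x | (H *ᵥ x) i ≤ h i} := by
    ext x
    simp [polyhedron]
  rw [this]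
  refine isClosed_iInter fun i => isClosed_le ?_ continuous_const
  fun_prop

theorem convex_pontryaginDiff {P S : Set (Fin n → ℝ)} (hP : Convex ℝ P) :
    Convex ℝ (pontryaginDiff P S) := by
  intro x hx y hy a b ha hb hab s hs
  have e : a • x + b • y + s = a • (x + s) + b • (y + s) := by
    rw [smul_add, smul_add, add_add_add_comm, ← add_smul, hab, one_smul]
  rw [e]
  exact hP (hx s hs) (hy s hs) ha hb hab

theorem isClosed_pontryaginDiff {P S : Set (Fin n → ℝ)} (hP : IsClosed P) :
    IsClosed (pontryaginDiff P S) := by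
  have : pontryaginDiff P S = ⋂ s ∈ S, (fun x => x + s) ⁻¹' P := by
    ext x
    simp [pontryaginDiff]
  rw [this]
  exact isClosed_biInter fun s _ => hP.preimage (by fun_prop)

theorem pontryaginDiff_subset {P S : Set (Fin n → ℝ)} (h0 : 0 ∈ S) : pontryaginDiff P S ⊆ P :=
  fun x hx => by simpa using hx 0 h0

/-- A uniform margin around a shrunk convex set. -/
theorem exists_add_mem_of_mem_smul {S : Set (Fin n → ℝ)} (hS : Convex ℝ S) (h0 : 0 ∈ interior S)
    {c : ℝ} (hc0 : 0 ≤ c) (hc1 : c < 1) :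
    ∃ ε > 0, ∀ x ∈ c • S, ∀ v, ‖v‖ < ε → x + v ∈ S := by
  obtain ⟨δ, hδ, hball⟩ := Metric.mem_nhds_iff.1 (mem_interior_iff_mem_nhds.1 h0)
  have hc : 0 < 1 - c := sub_pos.2 hc1
  refine ⟨(1 - c) * δ, by positivity, ?_⟩
  rintro _ ⟨x, hx, rfl⟩ v hv
  -- `c • x + v` is the convex combination of `x` and `(1 - c)⁻¹ • v` with weights `c` and `1 - c`.
  have hv' : (1 - c)⁻¹ • v ∈ S := by
    apply hball
    rw [mem_ball_zero_iff, norm_smul, norm_inv, Real.norm_of_nonneg hc.le, inv_mul_eq_div,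
      div_lt_iff₀ hc, mul_comm]
    exact hv
  have := hS hx hv' hc0 hc.le (by ring)
  rwa [smul_inv_smul₀ hc.ne'] at this

end Sets

namespace TubeMPC

variable {nx nu mx mu mw : ℕ} {D : TubeMPC nx nu mx mu mw}

/-! ### Constraint sets -/

theorem convex_Xc : Convex ℝ D.Xc := convex_pontryaginDiff (convex_polyhedron _ _)

theorem convex_Uc : Convex ℝ D.Uc := convex_pontryaginDiff (convex_polyhedron _ _)

theorem zero_mem_Z (hD : D.Assumptions) : (0 : Fin nx → ℝ) ∈ D.Z :=
  ⟨fun _ => 0, fun _ => interior_subset hD.W_zero, by simp [hasSum_zero]⟩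

theorem isCompact_Xc (hD : D.Assumptions) : IsCompact D.Xc :=
  Metric.isCompact_of_isClosed_isBounded (isClosed_pontryaginDiff (isClosed_polyhedron _ _))
    (hD.X_bounded.subset (pontryaginDiff_subset (zero_mem_Z hD)))

theorem isCompact_Uc (hD : D.Assumptions) : IsCompact D.Uc :=
  Metric.isCompact_of_isClosed_isBounded (isClosed_pontryaginDiff (isClosed_polyhedron _ _))
    (hD.U_bounded.subset (pontryaginDiff_subset ⟨0, zero_mem_Z hD, by simp⟩))

/-- Robust positive invariance of `Z`. -/
theorem mulVec_add_mem_Z {z w : Fin nx → ℝ} (hz : z ∈ D.Z) (hw : w ∈ D.W) :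
    (D.A - D.B * D.K) *ᵥ z + w ∈ D.Z := by
  obtain ⟨v, hv, hs⟩ := hz
  -- The new disturbance becomes the zeroth term, and the old series moves up by one power.
  refine ⟨fun i => Nat.casesOn i w v, fun i => by cases i <;> simp [hw, hv], ?_⟩
  have h1 : HasSum (fun i => (D.A - D.B * D.K) *ᵥ (((D.A - D.B * D.K) ^ i) *ᵥ v i))
      ((D.A - D.B * D.K) *ᵥ z) :=
    hs.map (Matrix.mulVecLin (D.A - D.B * D.K)).toAddMonoidHom
      (show Continuous fun x => (D.A - D.B * D.K) *ᵥ x by fun_prop)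
  refine (hasSum_nat_add_iff' 1).1 ?_
  simpa [pow_succ', mulVec_mulVec] using h1

/-- This slack turns convergence of the nominal state into membership in finite time. -/
theorem exists_ball_add_Z_subset_X (hD : D.Assumptions) :
    ∃ ε > 0, ∀ z ∈ D.Z, ∀ v : Fin nx → ℝ, ‖v‖ < ε → v + z ∈ D.X := by
  obtain ⟨ε, hε, h⟩ := Metric.mem_nhds_iff.1 (mem_interior_iff_mem_nhds.1 hD.Xc_zero)
  exact ⟨ε, hε, fun z hz v hv => h (mem_ball_zero_iff.2 hv) z hz⟩

/-! ### Steady states and targets -/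

theorem IsSteady.eq {b : Fin nx → ℝ} {u : Fin nu → ℝ} (h : D.IsSteady b u) :
    D.A *ᵥ b + D.B *ᵥ u = b := by
  have h' : (D.A - 1) *ᵥ b + D.B *ᵥ u = 0 := h
  rw [sub_mulVec, one_mulVec, sub_add_eq_add_sub, sub_eq_zero] at h'
  exact h'

theorem IsSteady.segment {b b' : Fin nx → ℝ} {u u' : Fin nu → ℝ} (h : D.IsSteady b u)
    (h' : D.IsSteady b' u') (s t : ℝ) : D.IsSteady (s • b + t • b') (s • u + t • u') := by
  have e : (D.A - 1) *ᵥ (s • b + t • b') + D.B *ᵥ (s • u + t • u') =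
      s • ((D.A - 1) *ᵥ b + D.B *ᵥ u) + t • ((D.A - 1) *ᵥ b' + D.B *ᵥ u') := by
    simp only [mulVec_add, mulVec_smul]
    module
  unfold IsSteady at *
  rw [e, h, h', smul_zero, smul_zero, add_zero]

theorem isCompact_admissibleSteadyStates (hD : D.Assumptions) :
    IsCompact D.admissibleSteadyStates := by
  have e : D.admissibleSteadyStates = Prod.fst '' (((D.lam • D.Xc) ×ˢ (D.lam • D.Uc)) ∩
      {p : (Fin nx → ℝ) × (Fin nu → ℝ) | (D.A - 1) *ᵥ p.1 + D.B *ᵥ p.2 = 0}) := by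
    ext x
    simp [admissibleSteadyStates, IsSteady, and_assoc]
  rw [e]
  refine ((((isCompact_Xc hD).smul _).prod ((isCompact_Uc hD).smul _)).inter_right ?_).image
    continuous_fst
  exact isClosed_eq (by fun_prop) continuous_const

theorem convex_admissibleSteadyStates : Convex ℝ D.admissibleSteadyStates := by
  rintro x ⟨hx, u, hu, hxu⟩ y ⟨hy, v, hv, hyv⟩ a b ha hb hab
  exact ⟨(convex_Xc.smul _) hx hy ha hb hab, _, (convex_Uc.smul _) hu hv ha hb hab,
    hxu.segment hyv a b⟩

theorem zero_mem_admissibleSteadyStates (hD : D.Assumptions) :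
    (0 : Fin nx → ℝ) ∈ D.admissibleSteadyStates :=
  ⟨⟨0, interior_subset hD.Xc_zero, by simp⟩, 0, ⟨0, interior_subset hD.Uc_zero, by simp⟩,
    by simp [IsSteady]⟩

theorem exists_mem_targets (hD : D.Assumptions) (xr : Fin nx → ℝ) : ∃ xt, xt ∈ D.targets xr := by
  obtain ⟨xt, h, hmin⟩ := (isCompact_admissibleSteadyStates hD).exists_isMinOn
    ⟨0, zero_mem_admissibleSteadyStates hD⟩
    ((continuous_wnormSq D.T).comp (continuous_id.sub (continuous_const (y := xr)))).continuousOn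
  exact ⟨xt, h, fun y hy => hmin hy⟩

/-- The offset cost controls the distance to the target, which gives both uniqueness of the target
and convergence of the artificial steady states. -/
theorem wnormSq_target_add_le {xr xt b : Fin nx → ℝ} (hxt : xt ∈ D.targets xr)
    (hb : b ∈ D.admissibleSteadyStates) :
    wnormSq D.T (xt - xr) + wnormSq D.T (b - xt) ≤ wnormSq D.T (b - xr) :=
  wnormSq_sub_le_of_isMin D.T convex_admissibleSteadyStates hxt.1 hxt.2 hb

theorem targets_eq_singleton (hD : D.Assumptions) {xr xt : Fin nx → ℝ} (hxt : xt ∈ D.targets xr) :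
    D.targets xr = {xt} := by
  refine Set.eq_singleton_iff_unique_mem.2 ⟨hxt, fun y hy => ?_⟩
  by_contra hne
  have h1 := wnormSq_target_add_le hxt hy.1
  have h2 := hy.2 xt hxt.1
  have h3 := wnormSq_pos hD.T_posDef (sub_ne_zero.2 hne)
  linarith

theorem target_eq_reference (hD : D.Assumptions) {xr xt : Fin nx → ℝ} {ur : Fin nu → ℝ}
    (hr : D.IsSteady xr ur) (hxt : xt ∈ D.targets xr) (hx : xr ∈ D.lam • D.Xc)
    (hu : ur ∈ D.lam • D.Uc) : xt = xr := by
  by_contra hne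
  have h1 := hxt.2 xr ⟨hx, ur, hu, hr⟩
  have h2 := wnormSq_pos hD.T_posDef (sub_ne_zero.2 hne)
  rw [sub_self, wnormSq_zero] at h1
  linarith

/-! ### The terminal cost -/

theorem wnormSq_P_eq (hD : D.Assumptions) (v : Fin nx → ℝ) :
    wnormSq D.P v = wnormSq D.P ((D.A - D.B * D.Kbar) *ᵥ v) + wnormSq D.Q v
      + wnormSq D.R (D.Kbar *ᵥ v) := by
  have key : ∀ {m : ℕ} (F : Matrix (Fin m) (Fin nx) ℝ) (M : Matrix (Fin m) (Fin m) ℝ),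
      wnormSq (Fᵀ * M * F) v = wnormSq M (F *ᵥ v) := fun F M => by
    simp only [wnormSq]
    rw [← mulVec_mulVec, ← mulVec_mulVec, dotProduct_mulVec, vecMul_transpose]
  have hadd : ∀ M M' : Matrix (Fin nx) (Fin nx) ℝ,
      wnormSq (M + M') v = wnormSq M v + wnormSq M' v := fun M M' => by
    simp [wnormSq, add_mulVec]
  conv_lhs => rw [hD.P_eq]
  rw [hadd, hadd, key, key]

/-- Nonnegativity of `P` comes from the Lyapunov equation: the form does not increase along orbits
of `A - B * Kbar`, and these tend to zero. -/
theorem wnormSq_P_nonneg (hD : D.Assumptions) (v : Fin nx → ℝ) : 0 ≤ wnormSq D.P v := by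
  have hmono : ∀ k, wnormSq D.P (((D.A - D.B * D.Kbar) ^ k) *ᵥ v) ≤ wnormSq D.P v := fun k => by
    induction k with
    | zero => simp
    | succ k ih =>
      refine le_trans ?_ ih
      rw [pow_succ', ← mulVec_mulVec]
      set y := ((D.A - D.B * D.Kbar) ^ k) *ᵥ v
      have h1 := wnormSq_P_eq hD y
      have h2 := wnormSq_nonneg hD.Q_posDef y
      have h3 := wnormSq_nonneg hD.R_posDef (D.Kbar *ᵥ y)
      linarith
  have hlim := ((continuous_wnormSq D.P).tendsto 0).comp (hD.Kbar_stable.tendsto_pow_mulVec v)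
  rw [wnormSq_zero] at hlim
  exact le_of_tendsto' hlim hmono

/-! ### Infinite-horizon admissible plans -/

/-- An infinite-horizon plan satisfying all constraints of the MPC problem except the initial
condition, and following the terminal control law from time `N` on. -/
structure IsAdmissible (D : TubeMPC nx nu mx mu mw) (m : MPCPlan nx nu) : Prop where
  dynamics : ∀ i, m.x (i + 1) = D.A *ᵥ m.x i + D.B *ᵥ m.u i
  state_mem : ∀ i, m.x i ∈ D.Xc
  input_mem : ∀ i, m.u i ∈ D.Uc
  tail : ∀ i, D.N ≤ i → m.u i = m.ubar - D.Kbar *ᵥ (m.x i - m.xbar)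
  xbar_mem : m.xbar ∈ D.lam • D.Xc
  ubar_mem : m.ubar ∈ D.lam • D.Uc
  steady : D.IsSteady m.xbar m.ubar

/-- Continuation of a finite-horizon plan by the terminal control law. -/
def extend (D : TubeMPC nx nu mx mu mw) (m : MPCPlan nx nu) : MPCPlan nx nu where
  u i := if i < D.N then m.u i else
    m.ubar - D.Kbar *ᵥ (D.terminalState (m.x D.N) m.xbar m.ubar (i - D.N) - m.xbar)
  x i := if i < D.N then m.x i else D.terminalState (m.x D.N) m.xbar m.ubar (i - D.N)
  xbar := m.xbar
  ubar := m.ubar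

/-- The remainder of a plan from time `j` on. -/
def shift (m : MPCPlan nx nu) (j : ℕ) : MPCPlan nx nu where
  u i := m.u (i + j)
  x i := m.x (i + j)
  xbar := m.xbar
  ubar := m.ubar

theorem shift_zero (m : MPCPlan nx nu) : shift m 0 = m := rfl

theorem shift_shift (m : MPCPlan nx nu) (i j : ℕ) : shift (shift m i) j = shift m (i + j) := by
  simp only [shift, add_assoc, add_comm j i]

theorem terminal_step (b x : Fin nx → ℝ) (u : Fin nu → ℝ) :
    (D.A - D.B * D.Kbar) *ᵥ x + (D.B * D.Kbar) *ᵥ b + D.B *ᵥ u =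
      D.A *ᵥ x + D.B *ᵥ (u - D.Kbar *ᵥ (x - b)) := by
  simp only [sub_mulVec, mulVec_sub, mulVec_mulVec]
  abel

theorem extend_x_of_le (m : MPCPlan nx nu) {i : ℕ} (hi : i ≤ D.N) :
    (D.extend m).x i = m.x i := by
  rcases hi.lt_or_eq with h | rfl
  · simp [extend, h]
  · simp [extend, terminalState]

theorem extend_u_of_lt (m : MPCPlan nx nu) {i : ℕ} (hi : i < D.N) :
    (D.extend m).u i = m.u i := by
  simp [extend, hi]

theorem extend_u_of_le (m : MPCPlan nx nu) {i : ℕ} (hi : D.N ≤ i) :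
    (D.extend m).u i = m.ubar - D.Kbar *ᵥ ((D.extend m).x i - m.xbar) := by
  simp [extend, hi.not_gt]

/-- The terminal set constrains the entire orbit of the terminal law, so the continuation satisfies
the constraints at all times. -/
theorem Feasible.isAdmissible_extend {rcv : Prop} {xhat : Fin nx → ℝ} {m : MPCPlan nx nu}
    (h : D.Feasible rcv xhat m) : D.IsAdmissible (D.extend m) where
  dynamics i := by
    rcases lt_or_ge i D.N with hi | hi
    · rw [extend_x_of_le m (Nat.succ_le_of_lt hi), extend_x_of_le m hi.le, extend_u_of_lt m hi,
        h.dynamics i hi]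
    · obtain ⟨j, rfl⟩ := Nat.exists_eq_add_of_le hi
      have h1 : ¬ D.N + j + 1 < D.N := by lia
      have h2 : D.N + j + 1 - D.N = j + 1 := by lia
      simp only [extend, h1, h2, hi.not_gt, if_false, Nat.add_sub_cancel_left, terminalState]
      exact terminal_step _ _ _
  state_mem i := by
    by_cases hi : i < D.N
    · simpa [extend, hi] using h.state_mem i hi
    · simpa [extend, hi] using (h.terminal.1 (i - D.N)).1
  input_mem i := by
    by_cases hi : i < D.N
    · simpa [extend, hi] using h.input_mem i hi
    · simpa [extend, hi] using (h.terminal.1 (i - D.N)).2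
  tail i hi := extend_u_of_le m hi
  xbar_mem := h.terminal.2.1
  ubar_mem := h.terminal.2.2
  steady := h.steady

namespace IsAdmissible

variable {m : MPCPlan nx nu}

/-- With infinite plans, recursive feasibility needs no appended step: a tail of an admissible plan
is admissible. -/
theorem shift (h : D.IsAdmissible m) (j : ℕ) : D.IsAdmissible (shift m j) where
  dynamics i := by
    have := h.dynamics (i + j)
    rwa [add_right_comm] at this
  state_mem i := h.state_mem _
  input_mem i := h.input_mem _
  tail i hi := h.tail _ (by lia)
  xbar_mem := h.xbar_mem
  ubar_mem := h.ubar_mem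
  steady := h.steady

theorem terminalState_eq (h : D.IsAdmissible m) (k : ℕ) :
    D.terminalState (m.x D.N) m.xbar m.ubar k = m.x (D.N + k) := by
  induction k with
  | zero => rfl
  | succ k ih =>
    rw [terminalState, ih, terminal_step, ← h.tail _ (Nat.le_add_right _ _), ← h.dynamics]
    rfl

theorem feasible (h : D.IsAdmissible m) {rcv : Prop} {xhat : Fin nx → ℝ}
    (h1 : rcv → {xhat} + D.W ⊆ {m.x 0} + D.Z) (h2 : ¬ rcv → m.x 0 = xhat) :
    D.Feasible rcv xhat m where
  dynamics i _ := h.dynamics i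
  state_mem i _ := h.state_mem i
  input_mem i _ := h.input_mem i
  init_received := h1
  init_lost := h2
  terminal := by
    refine ⟨fun k => ?_, h.xbar_mem, h.ubar_mem⟩
    rw [h.terminalState_eq, ← h.tail _ (Nat.le_add_right _ _)]
    exact ⟨h.state_mem _, h.input_mem _⟩
  steady := h.steady

theorem xbar_mem_admissibleSteadyStates (h : D.IsAdmissible m) :
    m.xbar ∈ D.admissibleSteadyStates :=
  ⟨h.xbar_mem, m.ubar, h.ubar_mem, h.steady⟩

end IsAdmissible

/-- The stage cost of a plan at time `i`. -/
def stageCost (D : TubeMPC nx nu mx mu mw) (m : MPCPlan nx nu) (i : ℕ) : ℝ :=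
  wnormSq D.Q (m.x i - m.xbar) + wnormSq D.R (m.u i - m.ubar)

theorem stageCost_nonneg (hD : D.Assumptions) (m : MPCPlan nx nu) (i : ℕ) :
    0 ≤ D.stageCost m i :=
  add_nonneg (wnormSq_nonneg hD.Q_posDef _) (wnormSq_nonneg hD.R_posDef _)

theorem cost_extend (xr : Fin nx → ℝ) (m : MPCPlan nx nu) :
    D.cost xr (D.extend m) = D.cost xr m := by
  unfold cost
  rw [extend_x_of_le m le_rfl]
  congr 1
  refine Finset.sum_congr rfl fun i hi => ?_
  have hi' := Finset.mem_range.1 hi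
  rw [extend_x_of_le m hi'.le, extend_u_of_lt m hi']
  rfl

/-- The Lyapunov equation applied to the deviation from the steady state; equality there makes the
cost decrease in `cost_shift` exact. -/
theorem terminalCost_succ (hD : D.Assumptions) {m : MPCPlan nx nu} (hs : D.IsSteady m.xbar m.ubar)
    {i : ℕ} (hdyn : m.x (i + 1) = D.A *ᵥ m.x i + D.B *ᵥ m.u i)
    (hu : m.u i = m.ubar - D.Kbar *ᵥ (m.x i - m.xbar)) :
    wnormSq D.P (m.x (i + 1) - m.xbar) + D.stageCost m i = wnormSq D.P (m.x i - m.xbar) := by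
  have e1 : m.u i - m.ubar = -(D.Kbar *ᵥ (m.x i - m.xbar)) := by
    rw [hu]
    abel
  have e2 : m.x (i + 1) - m.xbar = (D.A - D.B * D.Kbar) *ᵥ (m.x i - m.xbar) := by
    have e : m.x (i + 1) - m.xbar = m.x (i + 1) - (D.A *ᵥ m.xbar + D.B *ᵥ m.ubar) := by
      rw [hs.eq]
    rw [e, hdyn, hu]
    simp only [sub_mulVec, mulVec_sub, mulVec_mulVec]
    abel
  rw [wnormSq_P_eq hD (m.x i - m.xbar), ← e2, stageCost, e1, wnormSq_neg]
  ring

theorem IsAdmissible.cost_shift (hD : D.Assumptions) (xr : Fin nx → ℝ) {m : MPCPlan nx nu}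
    (h : D.IsAdmissible m) : D.cost xr (TubeMPC.shift m 1) = D.cost xr m - D.stageCost m 0 := by
  have h1 := terminalCost_succ hD h.steady (h.dynamics D.N) (h.tail D.N le_rfl)
  have h2 := Finset.sum_range_succ (D.stageCost m) D.N
  have h3 := Finset.sum_range_succ' (D.stageCost m) D.N
  change (∑ i ∈ Finset.range D.N, D.stageCost m (i + 1))
    + (wnormSq D.P (m.x (D.N + 1) - m.xbar) + wnormSq D.T (m.xbar - xr)) =
    (∑ i ∈ Finset.range D.N, D.stageCost m i)
    + (wnormSq D.P (m.x D.N - m.xbar) + wnormSq D.T (m.xbar - xr)) - D.stageCost m 0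
  linarith

theorem le_cost (hD : D.Assumptions) (xr : Fin nx → ℝ) (m : MPCPlan nx nu) :
    wnormSq D.T (m.xbar - xr) ≤ D.cost xr m := by
  have h1 : 0 ≤ ∑ i ∈ Finset.range D.N, D.stageCost m i :=
    Finset.sum_nonneg fun i _ => stageCost_nonneg hD m i
  have h2 := wnormSq_P_nonneg hD (m.x D.N - m.xbar)
  change _ ≤ (∑ i ∈ Finset.range D.N, D.stageCost m i)
    + (wnormSq D.P (m.x D.N - m.xbar) + wnormSq D.T (m.xbar - xr))
  linarith

/-! ### Plans following the terminal control law -/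

/-- The plan following the terminal control law from the initial state `z`. -/
def linearPlan (D : TubeMPC nx nu mx mu mw) (z b : Fin nx → ℝ) (u : Fin nu → ℝ) :
    MPCPlan nx nu where
  x i := b + ((D.A - D.B * D.Kbar) ^ i) *ᵥ (z - b)
  u i := u - D.Kbar *ᵥ (((D.A - D.B * D.Kbar) ^ i) *ᵥ (z - b))
  xbar := b
  ubar := u

theorem linearPlan_x_zero (z b : Fin nx → ℝ) (u : Fin nu → ℝ) : (D.linearPlan z b u).x 0 = z := by
  simp [linearPlan]

theorem linearPlan_u (z b : Fin nx → ℝ) (u : Fin nu → ℝ) (i : ℕ) :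
    (D.linearPlan z b u).u i = u - D.Kbar *ᵥ ((D.linearPlan z b u).x i - b) := by
  simp [linearPlan]

theorem linearPlan_dynamics {z b : Fin nx → ℝ} {u : Fin nu → ℝ} (h : D.IsSteady b u) (i : ℕ) :
    (D.linearPlan z b u).x (i + 1) =
      D.A *ᵥ (D.linearPlan z b u).x i + D.B *ᵥ (D.linearPlan z b u).u i := by
  simp only [linearPlan, pow_succ']
  rw [← mulVec_mulVec]
  set y := ((D.A - D.B * D.Kbar) ^ i) *ᵥ (z - b)
  conv_lhs => rw [← h.eq]
  simp only [sub_mulVec, mulVec_sub, mulVec_add, mulVec_mulVec]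
  abel

theorem cost_linearPlan (hD : D.Assumptions) (xr : Fin nx → ℝ) {z b : Fin nx → ℝ}
    {u : Fin nu → ℝ} (h : D.IsSteady b u) :
    D.cost xr (D.linearPlan z b u) = wnormSq D.P (z - b) + wnormSq D.T (b - xr) := by
  set m := D.linearPlan z b u with hm
  have key : ∀ j, (∑ i ∈ Finset.range j, D.stageCost m i) + wnormSq D.P (m.x j - b) =
      wnormSq D.P (z - b) := fun j => by
    induction j with
    | zero => simp [hm, linearPlan_x_zero]
    | succ j ih =>
      rw [← ih, Finset.sum_range_succ]
      have : wnormSq D.P (m.x (j + 1) - b) + D.stageCost m j = wnormSq D.P (m.x j - b) :=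
        terminalCost_succ hD (m := m) h (linearPlan_dynamics h j) (linearPlan_u z b u j)
      linarith
  have := key D.N
  change (∑ i ∈ Finset.range D.N, D.stageCost m i)
    + (wnormSq D.P (m.x D.N - b) + wnormSq D.T (b - xr)) = _
  linarith

/-- Since `lam < 1`, artificial steady states keep a uniform margin to the constraints, and bounded
powers of `A - B * Kbar` keep small deviations within it. The radius does not depend on the steady
state. -/
theorem exists_isAdmissible_linearPlan (hD : D.Assumptions) :
    ∃ δ > 0, ∀ (z b : Fin nx → ℝ) (u : Fin nu → ℝ), b ∈ D.lam • D.Xc → u ∈ D.lam • D.Uc →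
      D.IsSteady b u → ‖z - b‖ < δ → D.IsAdmissible (D.linearPlan z b u) := by
  obtain ⟨ε, hε, hX⟩ := exists_add_mem_of_mem_smul convex_Xc hD.Xc_zero hD.lam_pos.le hD.lam_lt_one
  obtain ⟨η, hη, hU⟩ := exists_add_mem_of_mem_smul convex_Uc hD.Uc_zero hD.lam_pos.le hD.lam_lt_one
  obtain ⟨C, hC, hpow⟩ := hD.Kbar_stable.exists_norm_pow_mulVec_le
  obtain ⟨C', hC', hK⟩ := exists_norm_mulVec_le D.Kbar
  refine ⟨min (ε / C) (η / (C' * C)), by positivity, fun z b u hb hu hs hz => ?_⟩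
  have hz1 : C * ‖z - b‖ < ε := (lt_div_iff₀' hC).1 (hz.trans_le (min_le_left _ _))
  have hz2 : C' * C * ‖z - b‖ < η :=
    (lt_div_iff₀' (by positivity)).1 (hz.trans_le (min_le_right _ _))
  refine ⟨linearPlan_dynamics hs, fun i => hX _ hb _ ((hpow _ _).trans_lt hz1), fun i => ?_,
    fun i _ => linearPlan_u z b u i, hb, hu, hs⟩
  change u - _ ∈ D.Uc
  rw [sub_eq_add_neg]
  refine hU _ hu _ (lt_of_le_of_lt ?_ hz2)
  rw [norm_neg, mul_assoc]
  exact (hK _).trans (by gcongr; exact hpow _ _)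

end TubeMPC

namespace TubeMPC

variable {nx nu mx mu mw : ℕ} {D : TubeMPC nx nu mx mu mw}

/-! ### Convergence of sequences of plans -/

/-- Moving the artificial steady state towards the target contracts the suboptimality, up to the
distance of the initial state from the artificial steady state. -/
theorem exists_cost_contraction (hD : D.Assumptions) {xr xt : Fin nx → ℝ}
    (hxt : xt ∈ D.targets xr) :
    ∃ α > 0, ∃ C, ∃ δ > 0, α ≤ (1 : ℝ) ∧ ∀ m, D.IsAdmissible m → ∀ z : Fin nx → ℝ,
      ‖z - m.xbar‖ < δ → ∃ m', D.IsAdmissible m' ∧ m'.x 0 = z ∧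
        D.cost xr m' - wnormSq D.T (xt - xr) ≤
          C * ‖z - m.xbar‖ ^ 2 + (1 - α) * (D.cost xr m - wnormSq D.T (xt - xr)) := by
  obtain ⟨hxX, ut, hut, hst⟩ := hxt.1
  obtain ⟨δ, hδ, hadm⟩ := exists_isAdmissible_linearPlan hD
  obtain ⟨CP, hCP, hP⟩ := exists_wnormSq_le D.P
  obtain ⟨cT, hcT, hT⟩ := exists_le_wnormSq hD.T_posDef
  obtain ⟨M, hM, hMb⟩ : ∃ M > 0, ∀ b ∈ D.lam • D.Xc, ‖b - xt‖ ≤ M := by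
    obtain ⟨M, hM⟩ := isBounded_iff_forall_norm_le.1 ((isCompact_Xc hD).smul D.lam).isBounded
    refine ⟨max M 1 + ‖xt‖, by positivity, fun b hb => (norm_sub_le _ _).trans ?_⟩
    gcongr
    exact (hM b hb).trans (le_max_left _ _)
  -- The three caps keep the combination convex, move the steady state by at most `δ / 2`, and let
  -- half of the linear gain in offset cost absorb the quadratic growth of the terminal cost.
  set α := min 1 (min (δ / (2 * M)) (cT / (4 * CP))) with hα
  have hα0 : 0 < α := by positivity
  have hα1 : α ≤ 1 := min_le_left _ _
  have hαM : α * M ≤ δ / 2 := by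
    have : α ≤ δ / (2 * M) := (min_le_right _ _).trans (min_le_left _ _)
    rw [le_div_iff₀ (by positivity)] at this
    linarith
  have hαC : α * (4 * CP) ≤ cT :=
    (le_div_iff₀ (by positivity)).1 ((min_le_right _ _).trans (min_le_right _ _))
  refine ⟨α / 2, by positivity, 2 * CP, δ / 2, by positivity, by linarith, fun m hm z hz => ?_⟩
  set b := m.xbar
  have hb : b ∈ D.lam • D.Xc := hm.xbar_mem
  set bα := (1 - α) • b + α • xt with hbα
  have hsα : D.IsSteady bα ((1 - α) • m.ubar + α • ut) := hm.steady.segment hst _ _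
  have hbz : ‖z - bα‖ ≤ ‖z - b‖ + α * ‖b - xt‖ := by
    have e : z - bα = (z - b) + α • (b - xt) := by
      rw [hbα]
      module
    rw [e]
    refine (norm_add_le _ _).trans_eq ?_
    rw [norm_smul, Real.norm_of_nonneg hα0.le]
  have hbM : α * ‖b - xt‖ ≤ δ / 2 :=
    (mul_le_mul_of_nonneg_left (hMb b hb) hα0.le).trans hαM
  refine ⟨D.linearPlan z bα ((1 - α) • m.ubar + α • ut),
    hadm _ _ _ (convex_Xc.smul _ hb hxX (by linarith) hα0.le (by ring))
      (convex_Uc.smul _ hm.ubar_mem hut (by linarith) hα0.le (by ring)) hsα (by linarith),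
    linearPlan_x_zero _ _ _, ?_⟩
  rw [cost_linearPlan hD xr hsα]
  set g := wnormSq D.T (b - xr) - wnormSq D.T (xt - xr) with hg
  have h1 : wnormSq D.P (z - bα) ≤ 2 * CP * ‖z - b‖ ^ 2 + α / 2 * g := by
    have hTg : wnormSq D.T (b - xt) ≤ g := by
      have := wnormSq_target_add_le hxt hm.xbar_mem_admissibleSteadyStates
      linarith
    calc wnormSq D.P (z - bα) ≤ CP * ‖z - bα‖ ^ 2 := hP _
      _ ≤ CP * (‖z - b‖ + α * ‖b - xt‖) ^ 2 := by gcongr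
      _ ≤ CP * (2 * (‖z - b‖ ^ 2 + (α * ‖b - xt‖) ^ 2)) := by
          gcongr
          exact add_sq_le
      _ = 2 * CP * ‖z - b‖ ^ 2 + α / 2 * (α * (4 * CP) * ‖b - xt‖ ^ 2) := by ring
      _ ≤ 2 * CP * ‖z - b‖ ^ 2 + α / 2 * (cT * ‖b - xt‖ ^ 2) := by gcongr
      _ ≤ 2 * CP * ‖z - b‖ ^ 2 + α / 2 * g := by
          gcongr
          exact (hT _).trans hTg
  have h2 : wnormSq D.T (bα - xr) - wnormSq D.T (xt - xr) ≤ (1 - α) * g := by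
    have e : bα - xr = (1 - α) • (b - xr) + α • (xt - xr) := by
      rw [hbα]
      module
    rw [e, wnormSq_segment]
    have := mul_nonneg (mul_nonneg hα0.le (sub_nonneg.2 hα1))
      (wnormSq_nonneg hD.T_posDef (xt - xr - (b - xr)))
    linarith
  -- The offset excess `g` is at most the excess of the full cost.
  have h3 : (1 - α / 2) * g ≤ (1 - α / 2) * (D.cost xr m - wnormSq D.T (xt - xr)) :=
    mul_le_mul_of_nonneg_left (by have := le_cost hD xr m; linarith) (by linarith)
  linarith

/-- A sequence of admissible plans whose cost decreases by at least the first stage cost, and which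
infinitely often is no worse than any plan started at the successor state, tracks the target. -/
theorem tendsto_target (hD : D.Assumptions) {xr xt : Fin nx → ℝ} (hxt : xt ∈ D.targets xr)
    {m : ℕ → MPCPlan nx nu} (hm : ∀ k, D.IsAdmissible (m k))
    (hdec : ∀ k, D.cost xr (m (k + 1)) ≤ D.cost xr (m k) - D.stageCost (m k) 0)
    (hopt : ∃ᶠ k in atTop, ∀ m', D.IsAdmissible m' →
      m'.x 0 = D.A *ᵥ (m k).x 0 + D.B *ᵥ (m k).u 0 → D.cost xr (m (k + 1)) ≤ D.cost xr m') :
    Tendsto (fun k => (m k).x 0) atTop (𝓝 xt) := by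
  set F : ℕ → ℝ := fun k => D.cost xr (m k) - wnormSq D.T (xt - xr) with hF
  have hgap : ∀ k, wnormSq D.T ((m k).xbar - xt) ≤ F k := fun k => by
    have h1 := wnormSq_target_add_le hxt (hm k).xbar_mem_admissibleSteadyStates
    have h2 := le_cost hD xr (m k)
    simp only [hF]
    linarith
  have hF0 : ∀ k, 0 ≤ F k := fun k => (wnormSq_nonneg hD.T_posDef _).trans (hgap k)
  have hstage : ∀ k, D.stageCost (m k) 0 ≤ F k - F (k + 1) := fun k => by
    have := hdec k
    simp only [hF]
    linarith
  have hanti : Antitone F := antitone_nat_of_succ_le fun k => by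
    have h1 := hstage k
    have h2 := stageCost_nonneg hD (m k) 0
    linarith
  obtain ⟨L, hL⟩ : ∃ L, Tendsto F atTop (𝓝 L) :=
    ⟨_, tendsto_atTop_ciInf hanti ⟨0, by rintro _ ⟨k, rfl⟩; exact hF0 k⟩⟩
  have hL' : Tendsto (fun k => F (k + 1)) atTop (𝓝 L) := (tendsto_add_atTop_iff_nat 1).2 hL
  have hdiff : Tendsto (fun k => F k - F (k + 1)) atTop (𝓝 0) := by simpa using hL.sub hL'
  have hx : Tendsto (fun k => (m k).x 0 - (m k).xbar) atTop (𝓝 0) :=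
    tendsto_zero_of_wnormSq hD.Q_posDef <| squeeze_zero
      (fun k => wnormSq_nonneg hD.Q_posDef _)
      (fun k => (le_add_of_nonneg_right (wnormSq_nonneg hD.R_posDef _)).trans (hstage k)) hdiff
  have hu : Tendsto (fun k => (m k).u 0 - (m k).ubar) atTop (𝓝 0) :=
    tendsto_zero_of_wnormSq hD.R_posDef <| squeeze_zero
      (fun k => wnormSq_nonneg hD.R_posDef _)
      (fun k => (le_add_of_nonneg_left (wnormSq_nonneg hD.Q_posDef _)).trans (hstage k)) hdiff
  have hz : Tendsto (fun k => ‖D.A *ᵥ (m k).x 0 + D.B *ᵥ (m k).u 0 - (m k).xbar‖) atTop (𝓝 0) := by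
    have hcont : Continuous fun p : (Fin nx → ℝ) × (Fin nu → ℝ) => D.A *ᵥ p.1 + D.B *ᵥ p.2 := by
      fun_prop
    have h := ((hcont.tendsto (0, 0)).comp (hx.prodMk_nhds hu)).norm
    simp only [Function.comp_def, mulVec_zero, add_zero, norm_zero] at h
    -- By steadiness, the successor deviates from `xbar` by `A (x - xbar) + B (u - ubar)`.
    refine h.congr fun k => congrArg norm ?_
    conv_rhs => rw [← (hm k).steady.eq]
    simp only [mulVec_sub]
    abel
  obtain ⟨α, hα, C, δ, hδ, hα1, hcontr⟩ := exists_cost_contraction hD hxt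
  have hL0 : L = 0 := by
    have hlim : Tendsto (fun k => C * ‖D.A *ᵥ (m k).x 0 + D.B *ᵥ (m k).u 0 - (m k).xbar‖ ^ 2
        + (1 - α) * F k - F (k + 1)) atTop (𝓝 (C * 0 ^ 2 + (1 - α) * L - L)) :=
      (((hz.pow 2).const_mul C).add (hL.const_mul _)).sub hL'
    have hfreq : ∃ᶠ k in atTop, 0 ≤ C * ‖D.A *ᵥ (m k).x 0 + D.B *ᵥ (m k).u 0 - (m k).xbar‖ ^ 2
        + (1 - α) * F k - F (k + 1) := by
      refine (hopt.and_eventually (hz.eventually_lt_const hδ)).mono fun k hk => ?_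
      obtain ⟨m', hm', hx0, hc⟩ := hcontr (m k) (hm k) _ hk.2
      have := hk.1 m' hm' hx0
      simp only [hF]
      linarith
    -- The contraction holds only frequently, but both sides converge, so it passes to the limit as
    -- `L ≤ (1 - α) * L`.
    have h0 : 0 ≤ C * 0 ^ 2 + (1 - α) * L - L := ge_of_tendsto_of_frequently hlim hfreq
    have h1 : 0 ≤ L := ge_of_tendsto' hL hF0
    nlinarith
  rw [hL0] at hL
  have hb : Tendsto (fun k => (m k).xbar - xt) atTop (𝓝 0) :=
    tendsto_zero_of_wnormSq hD.T_posDef <| squeeze_zero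
      (fun k => wnormSq_nonneg hD.T_posDef _) hgap hL
  simpa using (hx.add hb).add_const xt

/-! ### The closed loop -/

/-- The remainder at time `k` of the continuation of the plan in use at the plant. -/
def activePlan (D : TubeMPC nx nu mx mu mw) (p : LoopPath nx nu) (k : ℕ) : MPCPlan nx nu :=
  shift (D.extend (p.plan (p.s k))) (k - p.s k)

/-- At time `k` the nominal system follows an admissible plan, and the plant stays in the tube. -/
structure Tracking (D : TubeMPC nx nu mx mu mw) (p : LoopPath nx nu) (k : ℕ) : Prop where
  feasible : D.FeasibleAt p k
  q_lt : p.q k < k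
  s_le : p.s k ≤ k
  consistent : ∃ j ≤ k, p.Consistent j
  admissible : D.IsAdmissible (D.activePlan p k)
  state : p.xn k = (D.activePlan p k).x 0
  error : p.x k - p.xn k ∈ D.Z

variable {xr : Fin nx → ℝ} {p : LoopPath nx nu} {k : ℕ}

/-! ### Single-step relations between the loop signals -/

namespace IsClosedLoop

theorem activePlan_of_consistent (h : D.IsClosedLoop xr p) (hk : p.Consistent k) :
    D.activePlan p k = D.extend (p.plan k) := by
  rw [activePlan, h.s_consistent k hk, Nat.sub_self, shift_zero]

theorem activePlan_succ (h : D.IsClosedLoop xr p) (hs : p.s k ≤ k)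
    (hk : ¬ p.Consistent (k + 1)) :
    D.activePlan p (k + 1) = shift (D.activePlan p k) 1 := by
  rw [activePlan, activePlan, h.s_keep k hk, shift_shift, Nat.sub_add_comm hs]

theorem admissible_of_consistent (h : D.IsClosedLoop xr p) (hk : p.Consistent k)
    (hf : D.FeasibleAt p k) :
    D.IsAdmissible (D.activePlan p k) ∧ p.xn k = (D.activePlan p k).x 0 := by
  rw [h.activePlan_of_consistent hk, h.nominal_update k hk, extend_x_of_le _ (Nat.zero_le _)]
  exact ⟨(h.optimal k hf).1.isAdmissible_extend, rfl⟩

theorem predict_received (h : D.IsClosedLoop xr p) (hγ : p.γ k = true) :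
    p.xpred (k + 1) = D.A *ᵥ p.x k + D.B *ᵥ p.u k := by
  rw [h.predict, h.filt_state, h.filt_input, if_pos hγ, if_pos hγ]

theorem predict_lost (h : D.IsClosedLoop xr p) (hγ : ¬ p.γ k = true) :
    p.xpred (k + 1) = D.A *ᵥ (p.plan k).x 0 + D.B *ᵥ (p.plan k).u 0 := by
  rw [h.predict, h.filt_state, h.filt_input, if_neg hγ, if_neg hγ]

theorem error_succ (h : D.IsClosedLoop xr p) (k : ℕ) :
    p.x (k + 1) - (D.A *ᵥ p.xn k + D.B *ᵥ p.un k) =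
      (D.A - D.B * D.K) *ᵥ (p.x k - p.xn k) + p.w k := by
  rw [h.plant, h.ancillary]
  simp only [sub_mulVec, mulVec_sub, mulVec_mulVec]
  abel

/-- The initial constraint covers every possible disturbance, in particular the one that occurred.
-/
theorem error_mem_of_received (h : D.IsClosedLoop xr p) (hγ : p.γ k = true)
    {m : MPCPlan nx nu} (hm : D.Feasible (p.PrevReceived (k + 1)) (p.xpred (k + 1)) m) :
    p.x (k + 1) - m.x 0 ∈ D.Z := by
  have hmem : p.x (k + 1) ∈ ({p.xpred (k + 1)} + D.W : Set (Fin nx → ℝ)) := by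
    rw [h.plant, h.predict_received hγ]
    exact Set.add_mem_add rfl (h.dist_mem k)
  obtain ⟨_, rfl, z, hz, e⟩ := hm.init_received hγ hmem
  rw [← e]
  simpa using hz

theorem consistent_of_received (h : D.IsClosedLoop xr p) (hγ : p.γ k = true)
    (hθ : p.θ (k + 1) = true) : p.Consistent (k + 1) := by
  refine ⟨hθ, fun i hi hik => ?_⟩
  rw [h.q_update, if_pos hγ] at hi
  obtain rfl : i = k + 1 := by lia
  exact hθ

/-- Starts the induction: the packet is consistent whatever happened before, as only its own arrival
matters after `q (k + 1) = k`. -/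
theorem tracking_of_received (h : D.IsClosedLoop xr p) (hγ : p.γ k = true)
    (hθ : p.θ (k + 1) = true) (hf : D.FeasibleAt p (k + 1)) : D.Tracking p (k + 1) := by
  have hc := h.consistent_of_received hγ hθ
  obtain ⟨ha, hx⟩ := h.admissible_of_consistent hc hf
  refine ⟨hf, ?_, (h.s_consistent _ hc).le, ⟨_, le_rfl, hc⟩, ha, hx, ?_⟩
  · rw [h.q_update, if_pos hγ]
    lia
  · rw [h.nominal_update _ hc]
    exact h.error_mem_of_received hγ (h.optimal _ hf).1

end IsClosedLoop

/-! ### Invariance of tracking and decrease of the cost -/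

namespace Tracking

theorem input (ht : D.Tracking p k) (h : D.IsClosedLoop xr p) :
    p.un k = (D.activePlan p k).u 0 := by
  have hx := ht.state
  rw [h.actuator k ht.consistent]
  simp only [activePlan, shift, Nat.zero_add] at hx ⊢
  split_ifs with hN
  · rw [extend_u_of_lt _ hN]
  · rw [extend_u_of_le _ (not_lt.1 hN), ← hx, mulVec_sub]
    abel

theorem nominal_succ (ht : D.Tracking p k) (h : D.IsClosedLoop xr p) :
    (shift (D.activePlan p k) 1).x 0 = D.A *ᵥ p.xn k + D.B *ᵥ p.un k := by
  rw [ht.input h, ht.state]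
  exact ht.admissible.dynamics 0

theorem error_succ_mem (ht : D.Tracking p k) (h : D.IsClosedLoop xr p) :
    p.x (k + 1) - (D.A *ᵥ p.xn k + D.B *ᵥ p.un k) ∈ D.Z := by
  rw [h.error_succ]
  exact mulVec_add_mem_Z ht.error (h.dist_mem k)

/-- A lost plant packet leaves `q` unchanged and below `k`, so consistency at `k + 1` forces
consistency at `k`. Plant and controller then used the same plan, and the prediction is exact for
the nominal system. -/
theorem predict_lost (ht : D.Tracking p k) (h : D.IsClosedLoop xr p) (hN : 1 ≤ D.N)
    (hγ : ¬ p.γ k = true) (hc : p.Consistent (k + 1)) :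
    p.xpred (k + 1) = D.A *ᵥ p.xn k + D.B *ᵥ p.un k := by
  have hq : p.q (k + 1) = p.q k := by rw [h.q_update, if_neg hγ]
  have hck : p.Consistent k := by
    have hlt := ht.q_lt
    refine ⟨hc.2 k (by lia) k.le_succ, fun i hi hik => hc.2 i (by lia) (by lia)⟩
  rw [h.predict_lost hγ, ht.input h, h.nominal_update k hck, h.activePlan_of_consistent hck,
    extend_u_of_lt _ hN]

/-- Any admissible plan from the nominal successor may compete: invariance of `Z` gives the tube
condition after a received packet, and exact prediction gives the equality otherwise. -/
theorem feasible_succ (ht : D.Tracking p k) (h : D.IsClosedLoop xr p) (hN : 1 ≤ D.N)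
    (hk : p.γ k = true ∨ p.Consistent (k + 1)) {m : MPCPlan nx nu} (hm : D.IsAdmissible m)
    (hx : m.x 0 = D.A *ᵥ p.xn k + D.B *ᵥ p.un k) :
    D.Feasible (p.PrevReceived (k + 1)) (p.xpred (k + 1)) m := by
  refine hm.feasible (fun hγ => ?_) fun hγ => ?_
  · rw [h.predict_received hγ, h.ancillary]
    rintro _ ⟨_, rfl, w, hw, rfl⟩
    refine ⟨m.x 0, rfl, _, mulVec_add_mem_Z ht.error hw, ?_⟩
    simp only [hx, sub_mulVec, mulVec_sub, mulVec_mulVec]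
    abel
  · rw [hx, ht.predict_lost h hN hγ (hk.resolve_left hγ)]

theorem succ (ht : D.Tracking p k) (h : D.IsClosedLoop xr p) (hN : 1 ≤ D.N) :
    D.Tracking p (k + 1) := by
  have hf : D.FeasibleAt p (k + 1) := by
    by_cases hγ : p.γ k = true
    · exact ⟨_, ht.feasible_succ h hN (Or.inl hγ) (ht.admissible.shift 1) (ht.nominal_succ h)⟩
    -- The controller predicts from its own last plan, even if the plant never used it, so the tail
    -- of that plan is feasible.
    · have ha := (h.optimal k ht.feasible).1.isAdmissible_extend
      refine ⟨_, (ha.shift 1).feasible (fun hγ' => absurd hγ' hγ) fun _ => ?_⟩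
      rw [h.predict_lost hγ, ← extend_u_of_lt (p.plan k) hN,
        ← extend_x_of_le (D := D) (p.plan k) (Nat.zero_le _)]
      exact ha.dynamics 0
  have hq : p.q (k + 1) < (k + 1 : ℕ) := by
    have := ht.q_lt
    rw [h.q_update]
    split_ifs <;> lia
  obtain ⟨j, hj, hcj⟩ := ht.consistent
  by_cases hc : p.Consistent (k + 1)
  · obtain ⟨ha, hx⟩ := h.admissible_of_consistent hc hf
    refine ⟨hf, hq, (h.s_consistent _ hc).le, ⟨_, le_rfl, hc⟩, ha, hx, ?_⟩
    by_cases hγ : p.γ k = true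
    · rw [h.nominal_update _ hc]
      exact h.error_mem_of_received hγ (h.optimal _ hf).1
    -- Here the reset does not move the nominal state, so the usual error recursion applies.
    · rw [h.nominal_update _ hc, (h.optimal _ hf).1.init_lost hγ, ht.predict_lost h hN hγ hc]
      exact ht.error_succ_mem h
  · refine ⟨hf, hq, ?_, ⟨j, by lia, hcj⟩, ?_, ?_, ?_⟩
    · rw [h.s_keep k hc]
      exact ht.s_le.trans k.le_succ
    · rw [h.activePlan_succ ht.s_le hc]
      exact ht.admissible.shift 1
    · rw [h.activePlan_succ ht.s_le hc, ht.nominal_succ h, h.nominal k hc]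
    · rw [h.nominal k hc]
      exact ht.error_succ_mem h

theorem cost_succ_le_of_consistent (ht : D.Tracking p k) (h : D.IsClosedLoop xr p)
    (hN : 1 ≤ D.N) (hc : p.Consistent (k + 1)) {m : MPCPlan nx nu} (hm : D.IsAdmissible m)
    (hx : m.x 0 = D.A *ᵥ p.xn k + D.B *ᵥ p.un k) :
    D.cost xr (D.activePlan p (k + 1)) ≤ D.cost xr m := by
  rw [h.activePlan_of_consistent hc, cost_extend]
  exact (h.optimal _ (ht.succ h hN).feasible).2 m (ht.feasible_succ h hN (Or.inr hc) hm hx)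

theorem cost_succ_le (ht : D.Tracking p k) (h : D.IsClosedLoop xr p) (hD : D.Assumptions) :
    D.cost xr (D.activePlan p (k + 1)) ≤
      D.cost xr (D.activePlan p k) - D.stageCost (D.activePlan p k) 0 := by
  rw [← ht.admissible.cost_shift hD]
  by_cases hc : p.Consistent (k + 1)
  · exact ht.cost_succ_le_of_consistent h hD.horizon_pos hc (ht.admissible.shift 1)
      (ht.nominal_succ h)
  · rw [h.activePlan_succ ht.s_le hc]

end Tracking

/-! ### Convergence of tracked paths -/

theorem IsClosedLoop.tracking_add (h : D.IsClosedLoop xr p) (hN : 1 ≤ D.N)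
    (ht : D.Tracking p k) (i : ℕ) : D.Tracking p (i + k) := by
  induction i with
  | zero => simpa using ht
  | succ i ih =>
    rw [Nat.add_right_comm]
    exact ih.succ h hN

theorem IsClosedLoop.tendsto_nominal (h : D.IsClosedLoop xr p) (hD : D.Assumptions)
    {xt : Fin nx → ℝ} (hxt : xt ∈ D.targets xr) (ht : D.Tracking p k)
    (hnet : ∀ j, ∃ t ≥ j, p.γ t = true ∧ p.θ (t + 1) = true) :
    Tendsto p.xn atTop (𝓝 xt) := by
  have htr := h.tracking_add hD.horizon_pos ht
  have hsucc : ∀ i, i + 1 + k = i + k + 1 := fun i => Nat.add_right_comm i 1 k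
  refine (tendsto_add_atTop_iff_nat k).1 ?_
  have key := tendsto_target hD hxt (m := fun i => D.activePlan p (i + k))
    (fun i => (htr i).admissible)
    (fun i => by
      rw [hsucc]
      exact (htr i).cost_succ_le h hD)
    (frequently_atTop.2 fun j => by
      obtain ⟨t, htj, hγ, hθ⟩ := hnet (j + k)
      obtain ⟨i, rfl⟩ : ∃ i, t = i + k := ⟨t - k, by lia⟩
      refine ⟨i, by lia, fun m' hm' hx => ?_⟩
      rw [hsucc]
      rw [← (htr i).state, ← (htr i).input h] at hx
      exact (htr i).cost_succ_le_of_consistent h hD.horizon_pos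
        (h.consistent_of_received hγ hθ) hm' hx)
  exact key.congr fun i => (htr i).state.symm

theorem IsClosedLoop.convergence (h : D.IsClosedLoop xr p) (hD : D.Assumptions)
    {xt : Fin nx → ℝ} (hxt : xt ∈ D.targets xr) (ht : D.Tracking p k)
    (hnet : ∀ j, ∃ t ≥ j, p.γ t = true ∧ p.θ (t + 1) = true) :
    Tendsto (fun k => Metric.infDist (p.x k) ({xt} + D.Z)) atTop (𝓝 0) ∧
      ∀ᶠ k in atTop, p.x k ∈ ({xt} + D.X : Set (Fin nx → ℝ)) := by
  have hlim := h.tendsto_nominal hD hxt ht hnet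
  have hdist : Tendsto (fun i => ‖p.xn i - xt‖) atTop (𝓝 0) :=
    tendsto_iff_norm_sub_tendsto_zero.1 hlim
  have herr : ∀ᶠ i in atTop, p.x i - p.xn i ∈ D.Z := by
    filter_upwards [eventually_ge_atTop k] with i hi
    have := (h.tracking_add hD.horizon_pos ht (i - k)).error
    rwa [Nat.sub_add_cancel hi] at this
  constructor
  · refine squeeze_zero' (Eventually.of_forall fun _ => Metric.infDist_nonneg) ?_ hdist
    filter_upwards [herr] with i hi
    have hmem : xt + (p.x i - p.xn i) ∈ ({xt} + D.Z : Set (Fin nx → ℝ)) := Set.add_mem_add rfl hi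
    refine (Metric.infDist_le_dist_of_mem hmem).trans_eq ?_
    rw [dist_eq_norm]
    congr 1
    abel
  · obtain ⟨ε, hε, hball⟩ := exists_ball_add_Z_subset_X hD
    filter_upwards [herr, hdist.eventually_lt_const hε] with i hi hi'
    refine ⟨xt, rfl, _, hball _ hi _ hi', ?_⟩
    change xt + (p.xn i - xt + (p.x i - p.xn i)) = p.x i
    abel

end TubeMPC

/-- Almost surely, successful consecutive transmissions occur infinitely often. -/
theorem NetworkAssumption.ae_forall_exists {Ω : Type*} [MeasurableSpace Ω] {μ : Measure Ω}
    {nx nu : ℕ} {S : Ω → LoopPath nx nu} (h : NetworkAssumption μ S) :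
    ∀ᵐ ω ∂μ, ∀ k, ∃ t ≥ k, (S ω).γ t = true ∧ (S ω).θ (t + 1) = true := by
  refine ae_all_iff.2 fun k => ?_
  filter_upwards [measure_eq_zero_iff_ae_notMem.1 (h k)] with ω hω
  simpa [Set.mem_iInter, -not_and] using hω

theorem corollary2 {nx nu mx mu mw : ℕ} (D : TubeMPC nx nu mx mu mw) (hD : D.Assumptions)
    (xr : Fin nx → ℝ) (ur : Fin nu → ℝ) (hr : D.IsSteady xr ur)
    {Ω : Type*} [MeasurableSpace Ω] (μ : Measure Ω) [IsProbabilityMeasure μ]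
    (S : Ω → LoopPath nx nu)
    (hnet : NetworkAssumption μ S)
    (hloop : ∀ᵐ ω ∂μ, D.IsClosedLoop xr (S ω))
    (hinit : ∀ᵐ ω ∂μ, ∃ k : ℕ, (S ω).γ k = true ∧ (S ω).θ (k + 1) = true ∧
      D.FeasibleAt (S ω) (k + 1)) :
    ∃ xt : Fin nx → ℝ, D.targets xr = {xt} ∧
      (xr ∈ D.lam • D.Xc → ur ∈ D.lam • D.Uc → xt = xr) ∧
      ∀ᵐ ω ∂μ,
        Tendsto (fun k => Metric.infDist ((S ω).x k) ({xt} + D.Z)) atTop (𝓝 0) ∧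
        ∀ᶠ k in atTop, (S ω).x k ∈ ({xt} + D.X : Set (Fin nx → ℝ)) := by
  obtain ⟨xt, hxt⟩ := TubeMPC.exists_mem_targets hD xr
  refine ⟨xt, TubeMPC.targets_eq_singleton hD hxt, TubeMPC.target_eq_reference hD hr hxt, ?_⟩
  filter_upwards [hnet.ae_forall_exists, hloop, hinit] with ω h1 h2 h3
  obtain ⟨k, hγ, hθ, hf⟩ := h3
  exact h2.convergence hD hxt (h2.tracking_of_received hγ hθ hf) h1
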